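/- For each $n\ge 1$ let $M_n\subset\mathbb N$ be a finite or infinite set of urns and let $X_{n,1},\dots,X_{n,n}$ be i.i.d. random variables with values in $M_n$ (the urns into which the $n$ balls of the $n$-th experiment fall), with $p_{n,m}=\mathbb P(X_{n,1}=m)$, $m\in M_n$. Put $p_n^*=\sup_{m\in M_n}p_{n,m}$ and, for an integer $s\ge1$, $\mathbb E\,p_{X_n}^{s}=\sum_{m\in M_n}p_{n,m}^{s+1}$ (the expectation of $p_{n,X_n}^{s}$, where $X_n$ has the same law as $X_{n,1}$). For an integer $r\ge 1$ let $L_{n,r}$ be the number of urns that contain at least $r$ of the $n$ balls and $M_{n,r}$ the number of urns that contain exactly $r$ of them. For $\mu\ge 0$ let $\mathrm{Pois}(\mu)$ be the Poisson distribution with parameter $\mu$ (the point mass at $0$ if $\mu=0$). Assume that $n\,p_n^*\to 0$ as $n\to\infty$, and let $\mu\ge0$. 1. If $r>1$ and $n^r\,\mathbb E\,p_{X_n}^{r-1}\to r!\,\mu$, then $$L_{n,r}\xrightarrow{d}\mathrm{Pois}(\mu)\qquad\text{and}\qquad M_{n,r}\xrightarrow{d}\mathrm{Pois}(\mu).$$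 2. If $n^2\,\mathbb E\,p_{X_n}\to 2\mu$, then $$n-L_{n,1}\xrightarrow{d}\mathrm{Pois}(\mu)\qquad\text{and}\qquad \frac{n-M_{n,1}}{2}\xrightarrow{d}\mathrm{Pois}(\mu).$$ -/

import Mathlib

open MeasureTheory ProbabilityTheory Filter Topology
open scoped NNReal Nat

/-- The number of balls in urn `m`, when ball `k` is put in urn `x k`. -/
def ballCount {M : Type*} [DecidableEq M] {n : ℕ} (x : Fin n → M) (m : M) : ℕ :=
  (Finset.univ.filter (fun k => x k = m)).card

/-- The number of urns with at least `r` balls (for `r ≥ 1` there are finitely many of them). -/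
noncomputable def numFull {M : Type*} [DecidableEq M] {n : ℕ} (r : ℕ) (x : Fin n → M) : ℕ :=
  {m : M | r ≤ ballCount x m}.ncard

/-- The number of urns with exactly `r` balls (for `r ≥ 1` there are finitely many of them). -/
noncomputable def numExact {M : Type*} [DecidableEq M] {n : ℕ} (r : ℕ) (x : Fin n → M) : ℕ :=
  {m : M | ballCount x m = r}.ncard

/-- The probability `p_m` of urn `m`, when the urn of a ball has law `ν`. -/
noncomputable def boxProb {M : Type*} [MeasurableSpace M] (ν : Measure M) (m : M) : ℝ :=
  ν.real {m}

/-- `p^* = sup_m p_m`. -/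
noncomputable def maxBoxProb {M : Type*} [MeasurableSpace M] (ν : Measure M) : ℝ :=
  ⨆ m, boxProb ν m

/-- `𝔼 p_X ^ s`, where `X` has law `ν`. -/
noncomputable def meanPowBoxProb {M : Type*} [MeasurableSpace M] (ν : Measure M) (s : ℕ) : ℝ :=
  ∫ m, boxProb ν m ^ s ∂ν

/-!
The number `W` of sets of `r` balls that lie in a common urn is a sum of indicators, one for each
set `S` of `r` balls, and the indicators of disjoint sets are independent. Its mean is
`(n.choose r) * q` with `q = 𝔼 p_X ^ (r - 1)`, which tends to `μ` by assumption.

That `W` is asymptotically Poisson follows from the Chen–Stein identity, tested on indicators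
only. Write `W_S` for the number of such sets disjoint from `S`. If the balls of `S` share an urn,
then `W = W_S + 1` unless a further ball falls into that urn; `W_S` is independent of the balls in
`S`; and `W = W_S` unless some set meeting `S` shares an urn. Since
`(j + 1) * P(W = j + 1) = ∑ S, P(S shares an urn, W = j + 1)`, this gives
`(j + 1) * P(W = j + 1) - (n.choose r) * q * P(W = j) → 0`
(`abs_recursion_pi_real_numSameUrn_le`): the errors are bounded by `n ^ r * q * (n * p^*)` and
`r * (n ^ r * q) ^ 2 / n`. In the limit `P(W = j)` thus satisfies the recursion of the Poisson
weights up to the factor `P(W = 0)`, and that factor is determined by Markov's inequality, which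
prevents mass from escaping to infinity (`tendsto_poisson_of_recursion`). No solution of the Stein
equation is needed.

Finally, an urn with more than `r` balls exists with probability at most
`n ^ (r + 1) * 𝔼 p_X ^ r ≤ n ^ r * q * (n * p^*) → 0`, and if there is none, then all the
statistics of the theorem are equal to `W`
(with `r = 2` for `n - L_{n,1}` and `(n - M_{n,1}) / 2`).
-/

/-! ### Convergence to the Poisson distribution -/

/-- If `a n` satisfies the recursion of the Poisson weights asymptotically, it is asymptotically
proportional to them; the factor `a n 0` need not converge. -/
theorem tendsto_sub_mul_zeroth_of_recursion {a : ℕ → ℕ → ℝ} {μ : ℝ}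
    (hrec : ∀ j : ℕ, Tendsto (fun n => ((j : ℝ) + 1) * a n (j + 1) - μ * a n j) atTop (𝓝 0))
    (j : ℕ) : Tendsto (fun n => a n j - μ ^ j / (j ! : ℝ) * a n 0) atTop (𝓝 0) := by
  induction j with
  | zero => simp
  | succ j ih =>
    have h := ((hrec j).add (ih.const_mul μ)).div_const ((j : ℝ) + 1)
    simp only [mul_zero, add_zero, zero_div] at h
    refine h.congr fun n => ?_
    have h1 : (j : ℝ) + 1 ≠ 0 := by positivity
    have h2 : (j ! : ℝ) ≠ 0 := by positivity
    rw [Nat.factorial_succ]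
    push_cast
    field_simp
    ring

/-- The hypothesis `htail` is a uniform tail bound (tightness); it fixes the limit of `a n 0`. -/
theorem tendsto_poisson_of_recursion {a : ℕ → ℕ → ℝ} {μ C : ℝ}
    (ha : ∀ᶠ n in atTop, |a n 0| ≤ 1)
    (hrec : ∀ j : ℕ, Tendsto (fun n => ((j : ℝ) + 1) * a n (j + 1) - μ * a n j) atTop (𝓝 0))
    (htail : ∀ K : ℕ, ∀ᶠ n in atTop, (K : ℝ) * |1 - ∑ j ∈ Finset.range K, a n j| ≤ C)
    (j : ℕ) : Tendsto (fun n => a n j) atTop (𝓝 (Real.exp (-μ) * μ ^ j / (j ! : ℝ))) := by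
  have hrel := tendsto_sub_mul_zeroth_of_recursion hrec
  have hexp : Tendsto (fun K : ℕ => ∑ j ∈ Finset.range K, μ ^ j / (j ! : ℝ)) atTop
      (𝓝 (Real.exp μ)) := by
    have := (NormedSpace.expSeries_div_hasSum_exp (μ : ℝ)).tendsto_sum_nat
    rwa [← Real.exp_eq_exp_ℝ] at this
  -- summing the relation `a n j ≈ μ ^ j / j! * a n 0` over `j` gives `1 ≈ exp μ * a n 0`
  have hone : Tendsto (fun n => a n 0 * Real.exp μ) atTop (𝓝 1) := by
    rw [Metric.tendsto_nhds]
    intro ε hε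
    have hC : ∀ᶠ K : ℕ in atTop, C / K < ε / 3 :=
      (tendsto_const_div_atTop_nhds_zero_nat C).eventually_lt_const (by positivity)
    have hE : ∀ᶠ K : ℕ in atTop,
        |∑ j ∈ Finset.range K, μ ^ j / (j ! : ℝ) - Real.exp μ| < ε / 3 := by
      have := (Metric.tendsto_nhds.1 hexp) (ε / 3) (by positivity)
      simpa [Real.dist_eq] using this
    -- errors of `ε / 3` each: the mass beyond `K`, the tail of the exponential series, and, for large
    -- `n`, the deviation of `a n j` from `μ ^ j / j! * a n 0` for `j < K`
    obtain ⟨K, hKC, hKE, hK⟩ := (hC.and (hE.and (eventually_gt_atTop 0))).exists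
    have hK' : (0 : ℝ) < K := by exact_mod_cast hK
    have hsum : Tendsto
        (fun n => ∑ j ∈ Finset.range K, (a n j - μ ^ j / (j ! : ℝ) * a n 0)) atTop (𝓝 0) := by
      have := tendsto_finsetSum (Finset.range K) (fun j _ => hrel j)
      simpa using this
    have hsum' := (Metric.tendsto_nhds.1 hsum) (ε / 3) (by positivity)
    filter_upwards [hsum', htail K, ha] with n h1 h2 h0
    rw [Real.dist_eq, sub_zero, Finset.sum_sub_distrib, ← Finset.sum_mul] at h1
    have h3 : |1 - ∑ j ∈ Finset.range K, a n j| < ε / 3 := by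
      refine lt_of_le_of_lt ?_ hKC
      rw [le_div_iff₀ hK']
      linarith
    set s := ∑ j ∈ Finset.range K, μ ^ j / (j ! : ℝ)
    have h4 : |(s - Real.exp μ) * a n 0| < ε / 3 := by
      rw [abs_mul]
      exact lt_of_le_of_lt (mul_le_of_le_one_right (abs_nonneg _) h0) hKE
    rw [Real.dist_eq]
    rw [abs_lt] at *
    constructor <;> nlinarith
  have hzero : Tendsto (fun n => a n 0) atTop (𝓝 (Real.exp (-μ))) := by
    have := hone.mul_const (Real.exp (-μ))
    simpa [mul_assoc, ← Real.exp_add] using this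
  have h := (hrel j).add (hzero.const_mul (μ ^ j / (j ! : ℝ)))
  have e : Real.exp (-μ) * μ ^ j / (j ! : ℝ) = 0 + μ ^ j / (j ! : ℝ) * Real.exp (-μ) := by ring
  rw [e]
  exact h.congr fun n => by ring

/-- Real random variables whose probabilities at the natural numbers converge to the Poisson weights
converge in distribution. They need not be integer valued: the Poisson weights sum to `1`, so
no mass is left elsewhere in the limit. -/
theorem tendstoInDistribution_poisson_of_tendsto_singleton
    {Ω : ℕ → Type*} [∀ n, MeasurableSpace (Ω n)]
    {P : (n : ℕ) → Measure (Ω n)} [∀ n, IsProbabilityMeasure (P n)]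
    {Y : (n : ℕ) → Ω n → ℝ} {μ : ℝ≥0} (hY : ∀ n, AEMeasurable (Y n) (P n))
    (h : ∀ j : ℕ, Tendsto (fun n => (P n).real {ω | Y n ω = j}) atTop
      (𝓝 (Real.exp (-μ) * (μ : ℝ) ^ j / (j ! : ℝ)))) :
    TendstoInDistribution Y atTop (fun j : ℕ => (j : ℝ)) P (poissonMeasure μ) := by
  have hc : AEMeasurable (fun j : ℕ => (j : ℝ)) (poissonMeasure μ) :=
    (measurable_of_countable _).aemeasurable
  refine ⟨hY, hc, ?_⟩
  apply tendsto_of_forall_isOpen_le_liminf'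
  intro G hG
  simp only [ProbabilityMeasure.coe_mk]
  have hGm : MeasurableSet G := hG.measurableSet
  have hE : ∀ j : ℕ, Tendsto (fun n => (P n).map (Y n) {(j : ℝ)}) atTop
      (𝓝 (poissonMeasure μ {j})) := by
    intro j
    rw [poissonMeasure_singleton]
    refine (ENNReal.tendsto_ofReal (h j)).congr fun n => ?_
    rw [measureReal_def, ENNReal.ofReal_toReal (measure_ne_top _ _),
      Measure.map_apply_of_aemeasurable (hY n) (measurableSet_singleton _)]
    rfl
  -- both laws are compared on the atoms `{j}`; Fatou's lemma for sums gives the open set bound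
  rw [Measure.map_apply_of_aemeasurable hc hGm]
  set D : Set ℕ := (fun j : ℕ => (j : ℝ)) ⁻¹' G
  calc poissonMeasure μ D
      = ∑' j : D, poissonMeasure μ {(j : ℕ)} := by
        rw [← measure_biUnion (Set.to_countable D)]
        · simp
        · intro i _ j _ hij
          simpa using hij
        · intro i _
          exact measurableSet_singleton i
    _ = ∫⁻ j : D, liminf (fun n => (P n).map (Y n) {((j : ℕ) : ℝ)}) atTop ∂Measure.count := by
        rw [lintegral_count]
        exact tsum_congr fun j => (hE j).liminf_eq.symm
    _ ≤ liminf (fun n => ∫⁻ j : D, (P n).map (Y n) {((j : ℕ) : ℝ)} ∂Measure.count) atTop :=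
        lintegral_liminf_le fun n => measurable_of_countable _
    _ ≤ liminf (fun n => (P n).map (Y n) G) atTop := by
        refine liminf_le_liminf (Eventually.of_forall fun n => ?_)
        rw [lintegral_count, ← measure_iUnion]
        · refine measure_mono (Set.iUnion_subset fun j => ?_)
          exact Set.singleton_subset_iff.2 j.2
        · intro i j hij
          simpa [Function.onFun, Subtype.ext_iff] using hij
        · intro i
          exact measurableSet_singleton _

/-! ### Sets of balls in a common urn -/

/-- All the balls in `S` are in the same urn. -/
def SameUrn {M : Type*} {n : ℕ} (S : Finset (Fin n)) (x : Fin n → M) : Prop :=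
  ∀ k ∈ S, ∀ l ∈ S, x k = x l

open Classical in
/-- The number of sets of `r` balls, all taken from `U`, that are in one and the same urn. -/
noncomputable def numSameUrn {M : Type*} {n : ℕ} (r : ℕ) (U : Finset (Fin n)) (x : Fin n → M) : ℕ :=
  ((Finset.powersetCard r U).filter (fun S => SameUrn S x)).card

/-- Events that coincide outside `b` have probabilities that differ by at most that of `b`. -/
theorem abs_measureReal_sub_le {α : Type*} [MeasurableSpace α] {Q : Measure α}
    [IsFiniteMeasure Q] {s t b : Set α} (h : ∀ x ∉ b, (x ∈ s ↔ x ∈ t)) :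
    |Q.real s - Q.real t| ≤ Q.real b := by
  have h1 : Q.real s ≤ Q.real t + Q.real b :=
    (measureReal_mono fun x hx => by
      by_cases hb : x ∈ b
      · exact Or.inr hb
      · exact Or.inl ((h x hb).1 hx)).trans (measureReal_union_le t b)
  have h2 : Q.real t ≤ Q.real s + Q.real b :=
    (measureReal_mono fun x hx => by
      by_cases hb : x ∈ b
      · exact Or.inr hb
      · exact Or.inl ((h x hb).2 hx)).trans (measureReal_union_le s b)
  rw [abs_le]
  constructor <;> linarith

theorem measureReal_finset_exists_le {α ι : Type*} [MeasurableSpace α] {Q : Measure α}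
    [IsFiniteMeasure Q] (F : Finset ι) (A : ι → α → Prop) {c : ℝ}
    (h : ∀ i ∈ F, Q.real {x | A i x} ≤ c) : Q.real {x | ∃ i ∈ F, A i x} ≤ F.card * c := by
  have e : {x | ∃ i ∈ F, A i x} = ⋃ i ∈ F, {x | A i x} := by ext; simp
  rw [e]
  refine (measureReal_biUnion_finset_le F _).trans ?_
  rw [← nsmul_eq_mul]
  exact Finset.sum_le_card_nsmul _ _ _ h

section Law

variable {M : Type*} [MeasurableSpace M] {ν : Measure M}

theorem boxProb_nonneg (m : M) : 0 ≤ boxProb ν m := measureReal_nonneg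

theorem meanPowBoxProb_nonneg (s : ℕ) : 0 ≤ meanPowBoxProb ν s :=
  integral_nonneg fun m => pow_nonneg (boxProb_nonneg m) s

variable [IsProbabilityMeasure ν]

theorem boxProb_le_maxBoxProb (m : M) : boxProb ν m ≤ maxBoxProb ν :=
  le_ciSup (f := fun m => boxProb ν m) ⟨1, by rintro _ ⟨m, rfl⟩; exact measureReal_le_one⟩ m

variable [MeasurableSingletonClass M] [Countable M]

theorem integrable_boxProb_pow (s : ℕ) : Integrable (fun m => boxProb ν m ^ s) ν := by
  refine Integrable.of_bound (measurable_of_countable _).aestronglyMeasurable 1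
    (Eventually.of_forall fun m => ?_)
  rw [Real.norm_of_nonneg (pow_nonneg (boxProb_nonneg m) s)]
  exact pow_le_one₀ (boxProb_nonneg m) measureReal_le_one

theorem meanPowBoxProb_succ_le (s : ℕ) :
    meanPowBoxProb ν (s + 1) ≤ maxBoxProb ν * meanPowBoxProb ν s := by
  unfold meanPowBoxProb
  rw [← integral_const_mul]
  refine integral_mono (integrable_boxProb_pow _) ((integrable_boxProb_pow _).const_mul _) ?_
  intro m
  change boxProb ν m ^ (s + 1) ≤ maxBoxProb ν * boxProb ν m ^ s
  rw [pow_succ, mul_comm]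
  exact mul_le_mul_of_nonneg_right (boxProb_le_maxBoxProb m) (pow_nonneg (boxProb_nonneg m) s)

theorem pi_real_sameUrn {n : ℕ} {S : Finset (Fin n)} {s : ℕ} (hS : S.card = s + 1) :
    (Measure.pi fun _ : Fin n => ν).real {x | SameUrn S x} = meanPowBoxProb ν s := by
  obtain ⟨k₀, hk₀⟩ : S.Nonempty := Finset.card_pos.1 (by omega)
  have e : {x : Fin n → M | SameUrn S x} = ⋃ m : M, Set.pi S (fun _ => {m}) := by
    ext x
    simp only [SameUrn, Set.mem_ofPred_eq, Set.mem_iUnion, Set.mem_pi, Finset.mem_coe,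
      Set.mem_singleton_iff]
    exact ⟨fun h => ⟨x k₀, fun k hk => h k hk k₀ hk₀⟩,
      fun ⟨m, h⟩ k hk l hl => (h k hk).trans (h l hl).symm⟩
  have hfun : ∀ m, boxProb ν m ^ s = (ν {m} ^ s).toReal := by
    intro m
    rw [ENNReal.toReal_pow]
    rfl
  unfold meanPowBoxProb
  simp_rw [hfun]
  rw [integral_toReal (measurable_of_countable _).aemeasurable
    (Eventually.of_forall fun m => ENNReal.pow_lt_top (measure_lt_top _ _)),
    lintegral_countable', measureReal_def, e, measure_iUnion]
  · congr 1
    refine tsum_congr fun m => ?_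
    rw [Measure.pi_pi_finset, Finset.prod_const, hS, pow_succ]
  · intro m m' hm
    refine Set.disjoint_left.2 fun x hx hx' => hm ?_
    exact (hx k₀ hk₀).symm.trans (hx' k₀ hk₀)
  · exact fun m => (Set.to_countable _).measurableSet

/-- The event that the balls of `S` share an urn is independent of the number of sets disjoint from
`S` that do. -/
theorem pi_real_sameUrn_inter {n r : ℕ} (S : Finset (Fin n)) (j : ℕ) :
    (Measure.pi fun _ : Fin n => ν).real {x | SameUrn S x ∧ numSameUrn r Sᶜ x = j} =
      (Measure.pi fun _ : Fin n => ν).real {x | SameUrn S x} *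
        (Measure.pi fun _ : Fin n => ν).real {x | numSameUrn r Sᶜ x = j} := by
  have hi : iIndepFun (fun (k : Fin n) (x : Fin n → M) => x k) (Measure.pi fun _ => ν) :=
    iIndepFun_pi (X := fun _ => id) fun _ => aemeasurable_id
  -- both events are expressed through the restrictions of `x` to `S` and to its complement
  have hST := hi.indepFun_finset S Sᶜ disjoint_compl_right (fun k => measurable_pi_apply k)
  have h := hST.measure_inter_preimage_eq_mul
    {y : S → M | ∀ k l, y k = y l}
    {y : ((Sᶜ : Finset (Fin n)) → M) | ∃ x : Fin n → M,
      (∀ k : (Sᶜ : Finset (Fin n)), x k = y k) ∧ numSameUrn r Sᶜ x = j}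
    (Set.to_countable _).measurableSet (Set.to_countable _).measurableSet
  have e1 : (fun (x : Fin n → M) (k : S) => x k) ⁻¹' {y : S → M | ∀ k l, y k = y l} =
      {x | SameUrn S x} := by
    ext x
    simp [SameUrn]
  have e2 : (fun (x : Fin n → M) (k : (Sᶜ : Finset (Fin n))) => x k) ⁻¹'
      {y | ∃ x : Fin n → M, (∀ k : (Sᶜ : Finset (Fin n)), x k = y k) ∧ numSameUrn r Sᶜ x = j} =
      {x | numSameUrn r Sᶜ x = j} := by
    ext x
    constructor
    · rintro ⟨x', hx', rfl⟩
      classical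
      unfold numSameUrn
      refine congrArg Finset.card (Finset.filter_congr fun T hT => ?_)
      have hT' := (Finset.mem_powersetCard.1 hT).1
      have hx : ∀ k ∈ T, x' k = x k := fun k hk => hx' ⟨k, hT' hk⟩
      unfold SameUrn
      exact ⟨fun h k hk l hl => by rw [hx k hk, hx l hl, h k hk l hl],
        fun h k hk l hl => by rw [← hx k hk, ← hx l hl, h k hk l hl]⟩
    · exact fun h => ⟨x, fun _ => rfl, h⟩
  rw [e1, e2] at h
  simp only [measureReal_def, ← ENNReal.toReal_mul, ← h]
  rfl

/-- Linearity of expectation for `numSameUrn`, restricted to an event `D`. -/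
theorem sum_pi_real_sameUrn_inter {n r : ℕ} (D : Set (Fin n → M)) :
    ∑ S ∈ Finset.powersetCard r Finset.univ,
        (Measure.pi fun _ : Fin n => ν).real ({x | SameUrn S x} ∩ D) =
      ∫ x in D, (numSameUrn r Finset.univ x : ℝ) ∂(Measure.pi fun _ : Fin n => ν) := by
  classical
  have hm : ∀ A : Set (Fin n → M), MeasurableSet A := fun A => (Set.to_countable _).measurableSet
  have e : ∀ x : Fin n → M, (numSameUrn r Finset.univ x : ℝ) =
      ∑ S ∈ Finset.powersetCard r Finset.univ, Set.indicator {x | SameUrn S x} 1 x := by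
    intro x
    rw [numSameUrn, Finset.card_filter]
    simp only [Nat.cast_sum, Nat.cast_ite, Nat.cast_one, Nat.cast_zero, Set.indicator_apply,
      Set.mem_ofPred_eq, Pi.one_apply]
  simp_rw [e]
  rw [integral_finsetSum]
  · refine Finset.sum_congr rfl fun S _ => ?_
    rw [integral_indicator_one (hm _), measureReal_restrict_apply (hm _)]
  · exact fun S _ => (integrable_const (1 : ℝ)).indicator (hm _)

end Law

/-! ### Counting urns and sets of balls -/

section Counting

variable {M : Type*} {n r : ℕ} {x : Fin n → M}

theorem numSameUrn_univ_eq_add_one {S : Finset (Fin n)} (hr : 0 < r) (hS : S.card = r)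
    (hx : SameUrn S x) (h : ∀ k ∉ S, ¬ SameUrn (insert k S) x) :
    numSameUrn r Finset.univ x = numSameUrn r Sᶜ x + 1 := by
  classical
  have hSS : ¬ S ⊆ Sᶜ := fun hsub => by
    obtain ⟨k, hk⟩ : S.Nonempty := Finset.card_pos.1 (by omega)
    exact (Finset.mem_compl.1 (hsub hk)) hk
  have e : (Finset.powersetCard r Finset.univ).filter (fun T => SameUrn T x) =
      insert S ((Finset.powersetCard r Sᶜ).filter (fun T => SameUrn T x)) := by
    ext T
    simp only [Finset.mem_filter, Finset.mem_powersetCard, Finset.subset_univ, true_and,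
      Finset.mem_insert]
    constructor
    · rintro ⟨hT, hTx⟩
      by_cases hTS : T = S
      · exact Or.inl hTS
      refine Or.inr ⟨⟨fun l hlT => Finset.mem_compl.2 fun hlS => ?_, hT⟩, hTx⟩
      -- a ball of `T` outside `S` would share the urn of `S`, through the common ball `l`
      obtain ⟨k, hkT, hkS⟩ : ∃ k ∈ T, k ∉ S := by
        by_contra! hsub
        exact hTS (Finset.eq_of_subset_of_card_le hsub (by omega))
      have key : ∀ i ∈ insert k S, x i = x l := by
        intro i hi
        rcases Finset.mem_insert.1 hi with rfl | hi
        · exact hTx _ hkT _ hlT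
        · exact hx _ hi _ hlS
      exact h k hkS fun i hi i' hi' => (key i hi).trans (key i' hi').symm
    · rintro (rfl | ⟨⟨_, hT⟩, hTx⟩)
      · exact ⟨hS, hx⟩
      · exact ⟨hT, hTx⟩
  unfold numSameUrn
  rw [e, Finset.card_insert_of_notMem]
  exact fun hmem => hSS (Finset.mem_powersetCard.1 (Finset.mem_filter.1 hmem).1).1

theorem numSameUrn_univ_eq_compl {S : Finset (Fin n)}
    (h : ∀ T : Finset (Fin n), T.card = r → ¬ Disjoint S T → ¬ SameUrn T x) :
    numSameUrn r Finset.univ x = numSameUrn r Sᶜ x := by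
  classical
  unfold numSameUrn
  congr 1
  ext T
  simp only [Finset.mem_filter, Finset.mem_powersetCard, Finset.subset_univ, true_and]
  constructor
  · rintro ⟨hT, hTx⟩
    refine ⟨⟨?_, hT⟩, hTx⟩
    have hd : Disjoint S T := by
      by_contra hd
      exact h T hT hd hTx
    exact Finset.subset_compl_iff_disjoint_left.2 hd
  · rintro ⟨⟨_, hT⟩, hTx⟩
    exact ⟨hT, hTx⟩

/-- A set of `r` balls meeting `S` is a ball of `S` together with `r - 1` further balls. -/
theorem card_powersetCard_not_disjoint_le (S : Finset (Fin n)) :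
    ((Finset.powersetCard r Finset.univ).filter (fun T => ¬ Disjoint S T)).card ≤
      S.card * n ^ (r - 1) := by
  have hsub : (Finset.powersetCard r Finset.univ).filter (fun T => ¬ Disjoint S T) ⊆
      S.biUnion fun k => (Finset.powersetCard (r - 1) Finset.univ).image (insert k) := by
    intro T hT
    simp only [Finset.mem_filter, Finset.mem_powersetCard, Finset.subset_univ, true_and,
      Finset.not_disjoint_iff] at hT
    obtain ⟨hT, k, hkS, hkT⟩ := hT
    simp only [Finset.mem_biUnion, Finset.mem_image, Finset.mem_powersetCard,
      Finset.subset_univ, true_and]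
    exact ⟨k, hkS, T.erase k, by rw [Finset.card_erase_of_mem hkT, hT], Finset.insert_erase hkT⟩
  refine (Finset.card_le_card hsub).trans (Finset.card_biUnion_le_card_mul _ _ _ fun k _ => ?_)
  refine Finset.card_image_le.trans ?_
  rw [Finset.card_powersetCard, Finset.card_univ, Fintype.card_fin]
  exact Nat.choose_le_pow _ _

variable [DecidableEq M]

theorem ballCount_le_of_forall_not_sameUrn
    (h : ∀ T : Finset (Fin n), T.card = r + 1 → ¬ SameUrn T x) (m : M) : ballCount x m ≤ r := by
  by_contra! hm
  obtain ⟨T, hT, hTc⟩ := Finset.exists_subset_card_eq (Nat.succ_le_of_lt hm)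
  refine h T hTc fun k hk l hl => ?_
  exact (Finset.mem_filter.1 (hT hk)).2.trans (Finset.mem_filter.1 (hT hl)).2.symm

/-- If no urn has more than `r` balls, sending an urn to the set of its balls is a bijection from
the urns with `r` balls to the `r`-sets sharing an urn. -/
theorem numExact_eq_numSameUrn (hr : 0 < r) (h : ∀ m, ballCount x m ≤ r) :
    numExact r x = numSameUrn r Finset.univ x := by
  classical
  unfold numExact numSameUrn
  rw [← Set.ncard_coe_finset]
  refine Set.ncard_congr (fun m _ => Finset.univ.filter fun k => x k = m) ?_ ?_ ?_
  · intro m hm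
    simp only [Finset.coe_filter, Finset.mem_powersetCard, Finset.subset_univ, true_and,
      Set.mem_ofPred_eq]
    refine ⟨hm, fun k hk l hl => ?_⟩
    exact (Finset.mem_filter.1 hk).2.trans (Finset.mem_filter.1 hl).2.symm
  · intro m m' hm _ e
    obtain ⟨k, hk⟩ : (Finset.univ.filter fun k => x k = m).Nonempty :=
      Finset.card_pos.1 (lt_of_lt_of_eq hr (Eq.symm hm))
    have hk' : k ∈ Finset.univ.filter fun k => x k = m' := e ▸ hk
    exact (Finset.mem_filter.1 hk).2.symm.trans (Finset.mem_filter.1 hk').2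
  · intro S hS
    simp only [Finset.coe_filter, Finset.mem_powersetCard, Finset.subset_univ, true_and,
      Set.mem_ofPred_eq] at hS
    obtain ⟨hS, hSx⟩ := hS
    obtain ⟨k, hk⟩ : S.Nonempty := Finset.card_pos.1 (by omega)
    have e : S = Finset.univ.filter fun l => x l = x k :=
      Finset.eq_of_subset_of_card_le
        (fun l hl => Finset.mem_filter.2 ⟨Finset.mem_univ _, hSx l hl k hk⟩)
        (by rw [hS]; exact h (x k))
    exact ⟨x k, (congrArg Finset.card e).symm.trans hS, e.symm⟩

theorem numFull_eq_numExact (h : ∀ m, ballCount x m ≤ r) : numFull r x = numExact r x := by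
  unfold numFull numExact
  congr 1
  ext m
  exact ⟨fun hm => le_antisymm (h m) hm, fun hm => ge_of_eq hm⟩

theorem ballCount_pos_iff (m : M) : 0 < ballCount x m ↔ m ∈ Finset.univ.image x := by
  simp [ballCount, Finset.card_pos, Finset.filter_nonempty_iff]

theorem numExact_eq_sum (hr : 0 < r) :
    numExact r x = ∑ m ∈ Finset.univ.image x, if ballCount x m = r then 1 else 0 := by
  rw [← Finset.card_filter, ← Set.ncard_coe_finset, numExact]
  congr 1
  ext m
  simp only [Finset.coe_filter, Set.mem_ofPred_eq, ← ballCount_pos_iff]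
  omega

theorem numFull_one_eq_sum : numFull 1 x = ∑ _m ∈ Finset.univ.image x, 1 := by
  rw [← Finset.card_eq_sum_ones, ← Set.ncard_coe_finset, numFull]
  congr 1
  ext m
  rw [Finset.mem_coe, ← ballCount_pos_iff]
  rfl

theorem sum_ballCount : ∑ m ∈ Finset.univ.image x, ballCount x m = n := by
  have := Finset.card_eq_sum_card_image x Finset.univ
  rw [Finset.card_univ, Fintype.card_fin] at this
  exact this.symm

theorem numFull_one_add_numExact_two (h : ∀ m, ballCount x m ≤ 2) :
    numFull 1 x + numExact 2 x = n := by
  refine Eq.trans ?_ (sum_ballCount (x := x))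
  rw [numFull_one_eq_sum, numExact_eq_sum two_pos, ← Finset.sum_add_distrib]
  refine Finset.sum_congr rfl fun m hm => ?_
  have := (ballCount_pos_iff m).2 hm
  have := h m
  split_ifs <;> omega

theorem numExact_one_add_two_mul_numExact_two (h : ∀ m, ballCount x m ≤ 2) :
    numExact 1 x + 2 * numExact 2 x = n := by
  refine Eq.trans ?_ (sum_ballCount (x := x))
  rw [numExact_eq_sum one_pos, numExact_eq_sum two_pos, Finset.mul_sum, ← Finset.sum_add_distrib]
  refine Finset.sum_congr rfl fun m hm => ?_
  have := (ballCount_pos_iff m).2 hm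
  have := h m
  split_ifs <;> omega

end Counting

/-! ### The approximate recursion for the law of `numSameUrn` -/

section Estimates

variable {M : Type*} [MeasurableSpace M] [MeasurableSingletonClass M] [Countable M]
  {ν : Measure M} [IsProbabilityMeasure ν]

/-- The contribution of a single set `S` to the Chen–Stein recursion. The first error term bounds
the probability that a ball outside `S` joins the urn of `S`, the second one the probability that
some set meeting `S` shares an urn. -/
theorem abs_pi_real_sameUrn_inter_sub_le {n s : ℕ} {S : Finset (Fin n)} (hS : S.card = s + 1)
    (j : ℕ) :
    |(Measure.pi fun _ : Fin n => ν).real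
        ({x | SameUrn S x} ∩ {x | numSameUrn (s + 1) Finset.univ x = j + 1}) -
      meanPowBoxProb ν s *
        (Measure.pi fun _ : Fin n => ν).real {x | numSameUrn (s + 1) Finset.univ x = j}| ≤
      n * meanPowBoxProb ν (s + 1) +
        meanPowBoxProb ν s * ((s + 1) * n ^ s * meanPowBoxProb ν s) := by
  set Q := Measure.pi fun _ : Fin n => ν
  set q := meanPowBoxProb ν s with hq
  have hq0 : 0 ≤ q := meanPowBoxProb_nonneg s
  -- given that `S` shares an urn, the counts differ by one unless another ball joins that urn
  have h1 : |Q.real ({x | SameUrn S x} ∩ {x | numSameUrn (s + 1) Finset.univ x = j + 1}) -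
      Q.real {x | SameUrn S x ∧ numSameUrn (s + 1) Sᶜ x = j}| ≤ n * meanPowBoxProb ν (s + 1) := by
    refine (abs_measureReal_sub_le (b := {x | ∃ k ∈ Sᶜ, SameUrn (insert k S) x}) ?_).trans ?_
    · intro x hx
      simp only [Set.mem_ofPred_eq, not_exists, not_and, Finset.mem_compl] at hx
      refine and_congr_right fun hxS => ?_
      have := numSameUrn_univ_eq_add_one (r := s + 1) (Nat.succ_pos s) hS hxS hx
      simp only [Set.mem_ofPred_eq, this]
      omega
    · refine (measureReal_finset_exists_le (c := meanPowBoxProb ν (s + 1)) Sᶜ _ ?_).trans ?_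
      · intro k hk
        refine (pi_real_sameUrn ?_).le
        rw [Finset.card_insert_of_notMem (Finset.mem_compl.1 hk), hS]
      · refine mul_le_mul_of_nonneg_right ?_ (meanPowBoxProb_nonneg _)
        exact_mod_cast (Finset.card_le_univ _).trans_eq (Fintype.card_fin n)
  -- dropping the sets that meet `S` rarely changes the count
  have h2 : |Q.real {x | numSameUrn (s + 1) Sᶜ x = j} -
      Q.real {x | numSameUrn (s + 1) Finset.univ x = j}| ≤ (s + 1) * n ^ s * q := by
    refine (abs_measureReal_sub_le (b := {x | ∃ T ∈ (Finset.powersetCard (s + 1)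
      Finset.univ).filter (fun T => ¬ Disjoint S T), SameUrn T x}) ?_).trans ?_
    · intro x hx
      simp only [Set.mem_ofPred_eq, not_exists, not_and, Finset.mem_filter,
        Finset.mem_powersetCard, Finset.subset_univ, true_and] at hx
      simp only [Set.mem_ofPred_eq, numSameUrn_univ_eq_compl fun T hT hd => hx T ⟨hT, hd⟩]
    · refine (measureReal_finset_exists_le (c := q) _ _ ?_).trans ?_
      · intro T hT
        exact (pi_real_sameUrn (Finset.mem_powersetCard.1 (Finset.mem_filter.1 hT).1).2).le
      · refine mul_le_mul_of_nonneg_right ?_ hq0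
        have := card_powersetCard_not_disjoint_le (r := s + 1) S
        rw [hS, Nat.add_sub_cancel] at this
        exact_mod_cast this
  rw [pi_real_sameUrn_inter, pi_real_sameUrn hS, ← hq] at h1
  have h3 := mul_le_mul_of_nonneg_left h2 hq0
  rw [← abs_of_nonneg hq0, ← abs_mul, abs_of_nonneg hq0, mul_sub] at h3
  exact (abs_sub_le _ _ _).trans (add_le_add h1 h3)

/-- The Chen–Stein recursion for the law of `numSameUrn`, with an explicit error. -/
theorem abs_recursion_pi_real_numSameUrn_le (n s j : ℕ) :
    |((j : ℝ) + 1) *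
        (Measure.pi fun _ : Fin n => ν).real {x | numSameUrn (s + 1) Finset.univ x = j + 1} -
      n.choose (s + 1) * meanPowBoxProb ν s *
        (Measure.pi fun _ : Fin n => ν).real {x | numSameUrn (s + 1) Finset.univ x = j}| ≤
      n.choose (s + 1) * (n * meanPowBoxProb ν (s + 1) +
        meanPowBoxProb ν s * ((s + 1) * n ^ s * meanPowBoxProb ν s)) := by
  have hD : MeasurableSet {x : Fin n → M | numSameUrn (s + 1) Finset.univ x = j + 1} :=
    (Set.to_countable _).measurableSet
  have h := sum_pi_real_sameUrn_inter (ν := ν) (r := s + 1)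
    {x : Fin n → M | numSameUrn (s + 1) Finset.univ x = j + 1}
  have h' : ∫ x in {x : Fin n → M | numSameUrn (s + 1) Finset.univ x = j + 1},
      (numSameUrn (s + 1) Finset.univ x : ℝ) ∂(Measure.pi fun _ : Fin n => ν) =
      ((j : ℝ) + 1) *
        (Measure.pi fun _ : Fin n => ν).real {x | numSameUrn (s + 1) Finset.univ x = j + 1} := by
    rw [setIntegral_congr_fun (g := fun _ => (j : ℝ) + 1) hD fun x hx => ?_, setIntegral_const,
      smul_eq_mul, mul_comm]
    have hx' : numSameUrn (s + 1) Finset.univ x = j + 1 := hx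
    simp [hx']
  have hcard : (Finset.powersetCard (s + 1) (Finset.univ : Finset (Fin n))).card =
      n.choose (s + 1) := by simp
  rw [← h', ← h, mul_assoc, ← hcard, ← nsmul_eq_mul, ← nsmul_eq_mul, ← Finset.sum_const,
    ← Finset.sum_sub_distrib]
  refine (Finset.abs_sum_le_sum_abs _ _).trans (Finset.sum_le_card_nsmul _ _ _ fun S hS => ?_)
  exact abs_pi_real_sameUrn_inter_sub_le (Finset.mem_powersetCard.1 hS).2 j

/-- Markov's inequality for `numSameUrn`: the absolute value is the probability that it is at
least `K`. -/
theorem mul_abs_one_sub_sum_pi_real_numSameUrn_le (n s K : ℕ) :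
    (K : ℝ) * |1 - ∑ j ∈ Finset.range K,
        (Measure.pi fun _ : Fin n => ν).real {x | numSameUrn (s + 1) Finset.univ x = j}| ≤
      n.choose (s + 1) * meanPowBoxProb ν s := by
  have hm : ∀ A : Set (Fin n → M), MeasurableSet A := fun A => (Set.to_countable _).measurableSet
  set Q := Measure.pi fun _ : Fin n => ν
  set D : Set (Fin n → M) := {x | K ≤ numSameUrn (s + 1) Finset.univ x}
  have hsum : 1 - ∑ j ∈ Finset.range K, Q.real {x | numSameUrn (s + 1) Finset.univ x = j} =
      Q.real D := by
    rw [← measureReal_biUnion_finset (fun i _ j _ hij => ?_) fun j _ => hm _,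
      ← probReal_compl_eq_one_sub (hm _)]
    · congr 1
      ext x
      simp only [Set.mem_compl_iff, Set.mem_iUnion, Finset.mem_range, Set.mem_ofPred_eq,
        exists_prop, not_exists, not_and, D]
      exact ⟨fun h => not_lt.1 fun hlt => h _ hlt rfl, fun h i hi e => by omega⟩
    · refine Set.disjoint_left.2 fun x hx hx' => hij ?_
      exact Eq.trans (Eq.symm hx) hx'
  have hint : ∀ A, IntegrableOn (fun x : Fin n → M => (numSameUrn (s + 1) Finset.univ x : ℝ))
      A Q := by
    intro A
    refine (Integrable.of_bound (measurable_of_countable _).aestronglyMeasurable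
      ((Finset.powersetCard (s + 1) (Finset.univ : Finset (Fin n))).card : ℝ)
      (Eventually.of_forall fun x => ?_)).integrableOn
    rw [Real.norm_natCast]
    classical
    exact_mod_cast Finset.card_filter_le _ _
  rw [hsum, abs_of_nonneg measureReal_nonneg]
  calc (K : ℝ) * Q.real D = ∫ _ in D, (K : ℝ) ∂Q := by
        rw [setIntegral_const, smul_eq_mul, mul_comm]
    _ ≤ ∫ x in D, (numSameUrn (s + 1) Finset.univ x : ℝ) ∂Q := by
        refine setIntegral_mono_on (integrable_const _).integrableOn (hint D) (hm D) fun x hx => ?_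
        exact_mod_cast hx
    _ = ∑ S ∈ Finset.powersetCard (s + 1) Finset.univ, Q.real ({x | SameUrn S x} ∩ D) :=
        (sum_pi_real_sameUrn_inter D).symm
    _ ≤ ∑ S ∈ Finset.powersetCard (s + 1) (Finset.univ : Finset (Fin n)),
          meanPowBoxProb ν s := by
        refine Finset.sum_le_sum fun S hS => ?_
        rw [← pi_real_sameUrn (Finset.mem_powersetCard.1 hS).2]
        exact measureReal_mono Set.inter_subset_left
    _ = n.choose (s + 1) * meanPowBoxProb ν s := by simp

theorem pi_real_exists_sameUrn_le (n s : ℕ) :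
    (Measure.pi fun _ : Fin n => ν).real
        {x | ∃ T ∈ Finset.powersetCard (s + 1) Finset.univ, SameUrn T x} ≤
      n ^ (s + 1) * meanPowBoxProb ν s := by
  refine (measureReal_finset_exists_le (c := meanPowBoxProb ν s) _ _ fun T hT =>
    (pi_real_sameUrn (Finset.mem_powersetCard.1 hT).2).le).trans ?_
  refine mul_le_mul_of_nonneg_right ?_ (meanPowBoxProb_nonneg _)
  rw [Finset.card_powersetCard, Finset.card_univ, Fintype.card_fin]
  exact_mod_cast Nat.choose_le_pow _ _

end Estimates

/-! ### The Poisson limit -/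

section Limits

variable {M : ℕ → Type*} [∀ n, MeasurableSpace (M n)] {ν : (n : ℕ) → Measure (M n)}
  {s : ℕ} {μ : ℝ≥0}

theorem tendsto_choose_mul_meanPowBoxProb
    (hmean : Tendsto (fun n : ℕ => (n : ℝ) ^ (s + 1) * meanPowBoxProb (ν n) s) atTop
      (𝓝 (((s + 1)! : ℝ) * μ))) :
    Tendsto (fun n : ℕ => (n.choose (s + 1) : ℝ) * meanPowBoxProb (ν n) s) atTop (𝓝 μ) := by
  have h1 : Tendsto (fun n : ℕ => (n : ℝ) * (n : ℝ)⁻¹) atTop (𝓝 1) :=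
    tendsto_const_nhds.congr' ((eventually_gt_atTop 0).mono fun n hn => by
      have : (n : ℝ) ≠ 0 := by positivity
      field_simp)
  have h2 := (tendsto_choose_mul_pow_atTop (s + 1) h1).mul hmean
  have hf : ((s + 1)! : ℝ) ≠ 0 := by positivity
  have e : (1 : ℝ) ^ (s + 1) / ((s + 1)! : ℝ) * (((s + 1)! : ℝ) * μ) = μ := by
    field_simp
    simp
  rw [e] at h2
  refine h2.congr' ((eventually_gt_atTop 0).mono fun n hn => ?_)
  have : (n : ℝ) ≠ 0 := by positivity
  rw [inv_pow]
  field_simp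

variable [∀ n, MeasurableSingletonClass (M n)] [∀ n, Countable (M n)]

/-- The union bound for the existence of an urn with `s + 2` balls tends to `0`. -/
theorem tendsto_pow_mul_meanPowBoxProb_succ
    (hν : ∀ n, 0 < n → IsProbabilityMeasure (ν n))
    (hmax : Tendsto (fun n : ℕ => (n : ℝ) * maxBoxProb (ν n)) atTop (𝓝 0))
    (hmean : Tendsto (fun n : ℕ => (n : ℝ) ^ (s + 1) * meanPowBoxProb (ν n) s) atTop
      (𝓝 (((s + 1)! : ℝ) * μ))) :
    Tendsto (fun n : ℕ => (n : ℝ) ^ (s + 2) * meanPowBoxProb (ν n) (s + 1)) atTop (𝓝 0) := by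
  have h := hmean.mul hmax
  rw [mul_zero] at h
  refine tendsto_of_tendsto_of_tendsto_of_le_of_le' tendsto_const_nhds h
    (Eventually.of_forall fun n => mul_nonneg (by positivity) (meanPowBoxProb_nonneg _))
    ((eventually_gt_atTop 0).mono fun n hn => ?_)
  have := hν n hn
  calc (n : ℝ) ^ (s + 2) * meanPowBoxProb (ν n) (s + 1)
      ≤ (n : ℝ) ^ (s + 2) * (maxBoxProb (ν n) * meanPowBoxProb (ν n) s) := by
        gcongr
        exact meanPowBoxProb_succ_le s
    _ = (n : ℝ) ^ (s + 1) * meanPowBoxProb (ν n) s * (n * maxBoxProb (ν n)) := by ring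

theorem tendsto_pi_real_numSameUrn
    (hν : ∀ n, 0 < n → IsProbabilityMeasure (ν n))
    (hmax : Tendsto (fun n : ℕ => (n : ℝ) * maxBoxProb (ν n)) atTop (𝓝 0))
    (hmean : Tendsto (fun n : ℕ => (n : ℝ) ^ (s + 1) * meanPowBoxProb (ν n) s) atTop
      (𝓝 (((s + 1)! : ℝ) * μ))) (j : ℕ) :
    Tendsto (fun n => (Measure.pi fun _ : Fin n => ν n).real
      {x | numSameUrn (s + 1) Finset.univ x = j}) atTop
      (𝓝 (Real.exp (-μ) * (μ : ℝ) ^ j / (j ! : ℝ))) := by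
  have hchoose := tendsto_choose_mul_meanPowBoxProb hmean
  have hle : ∀ (n i : ℕ), 0 < n → |(Measure.pi fun _ : Fin n => ν n).real
      {x | numSameUrn (s + 1) Finset.univ x = i}| ≤ 1 := by
    intro n i hn
    have := hν n hn
    rw [abs_of_nonneg measureReal_nonneg]
    exact measureReal_le_one
  -- the total error term of the recursion
  have herr : Tendsto (fun n : ℕ => (n : ℝ) ^ (s + 2) * meanPowBoxProb (ν n) (s + 1) +
      (s + 1) * ((n : ℝ) ^ (s + 1) * meanPowBoxProb (ν n) s) ^ 2 * (n : ℝ)⁻¹) atTop (𝓝 0) := by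
    have h := (tendsto_pow_mul_meanPowBoxProb_succ hν hmax hmean).add
      (((hmean.pow 2).const_mul ((s : ℝ) + 1)).mul tendsto_inv_atTop_nhds_zero_nat)
    simpa using h
  refine tendsto_poisson_of_recursion (C := μ + 1)
    (a := fun n i => (Measure.pi fun _ : Fin n => ν n).real
      {x | numSameUrn (s + 1) Finset.univ x = i})
    ((eventually_gt_atTop 0).mono fun n hn => hle n 0 hn) (fun i => ?_) (fun K => ?_) j
  · have h1 : Tendsto (fun n : ℕ => ((i : ℝ) + 1) * (Measure.pi fun _ : Fin n => ν n).real
          {x | numSameUrn (s + 1) Finset.univ x = i + 1} -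
        n.choose (s + 1) * meanPowBoxProb (ν n) s * (Measure.pi fun _ : Fin n => ν n).real
          {x | numSameUrn (s + 1) Finset.univ x = i}) atTop (𝓝 0) := by
      refine squeeze_zero_norm' ((eventually_gt_atTop 0).mono fun n hn => ?_) herr
      have := hν n hn
      have hn' : (n : ℝ) ≠ 0 := by positivity
      have hq : 0 ≤ meanPowBoxProb (ν n) s := meanPowBoxProb_nonneg s
      have hq' : 0 ≤ meanPowBoxProb (ν n) (s + 1) := meanPowBoxProb_nonneg (s + 1)
      refine (abs_recursion_pi_real_numSameUrn_le n s i).trans ?_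
      calc _ ≤ (n : ℝ) ^ (s + 1) * (n * meanPowBoxProb (ν n) (s + 1) +
              meanPowBoxProb (ν n) s * ((s + 1) * n ^ s * meanPowBoxProb (ν n) s)) := by
            refine mul_le_mul_of_nonneg_right ?_ (by positivity)
            exact_mod_cast Nat.choose_le_pow n (s + 1)
        _ = _ := by
            field_simp
            ring
    have h2 : Tendsto (fun n : ℕ => (n.choose (s + 1) * meanPowBoxProb (ν n) s - μ) *
        (Measure.pi fun _ : Fin n => ν n).real
          {x | numSameUrn (s + 1) Finset.univ x = i}) atTop (𝓝 0) := by
      have h3 : Tendsto (fun n : ℕ => |n.choose (s + 1) * meanPowBoxProb (ν n) s - μ|) atTop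
          (𝓝 0) := by simpa using (hchoose.sub_const (μ : ℝ)).abs
      refine squeeze_zero_norm' ((eventually_gt_atTop 0).mono fun n hn => ?_) h3
      rw [Real.norm_eq_abs, abs_mul]
      exact mul_le_of_le_one_right (abs_nonneg _) (hle n i hn)
    have h := h1.add h2
    rw [add_zero] at h
    exact h.congr fun n => by ring
  · filter_upwards [eventually_gt_atTop 0, hchoose.eventually_le_const (lt_add_one (μ : ℝ))]
      with n hn h
    have := hν n hn
    exact (mul_abs_one_sub_sum_pi_real_numSameUrn_le n s K).trans h

/-- Any statistic that agrees with the number of `(s + 1)`-sets sharing an urn, as long as no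
`s + 2` balls share one, has the Poisson limit. -/
theorem tendstoInDistribution_poisson_of_eq_numSameUrn
    {Ω : ℕ → Type*} [∀ n, MeasurableSpace (Ω n)]
    {P : (n : ℕ) → Measure (Ω n)} [∀ n, IsProbabilityMeasure (P n)]
    {X : (n : ℕ) → Fin n → Ω n → M n}
    (hlaw : ∀ n k, HasLaw (X n k) (ν n) (P n))
    (hindep : ∀ n, iIndepFun (X n) (P n))
    (hmax : Tendsto (fun n : ℕ => (n : ℝ) * maxBoxProb (ν n)) atTop (𝓝 0))
    (hmean : Tendsto (fun n : ℕ => (n : ℝ) ^ (s + 1) * meanPowBoxProb (ν n) s) atTop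
      (𝓝 (((s + 1)! : ℝ) * μ)))
    (f : (n : ℕ) → (Fin n → M n) → ℝ)
    (hf : ∀ n x, (∀ T : Finset (Fin n), T.card = s + 2 → ¬ SameUrn T x) →
      f n x = numSameUrn (s + 1) Finset.univ x) :
    TendstoInDistribution (fun n ω => f n (fun k => X n k ω)) atTop
      (fun j : ℕ => (j : ℝ)) P (poissonMeasure μ) := by
  -- without balls there is no constraint on `ν 0`
  have hν : ∀ n, 0 < n → IsProbabilityMeasure (ν n) := fun n hn => by
    rw [← (hlaw n ⟨0, hn⟩).map_eq]
    exact Measure.isProbabilityMeasure_map (hlaw n ⟨0, hn⟩).aemeasurable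
  have hX : ∀ n, AEMeasurable (fun ω k => X n k ω) (P n) := fun n =>
    aemeasurable_pi_lambda _ fun k => (hlaw n k).aemeasurable
  have hmap : ∀ n, (P n).map (fun ω k => X n k ω) = Measure.pi fun _ : Fin n => ν n := by
    intro n
    rw [(hindep n).map_fun_eq_pi_map fun k => (hlaw n k).aemeasurable]
    simp_rw [(hlaw n _).map_eq]
  refine tendstoInDistribution_poisson_of_tendsto_singleton
    (fun n => (measurable_of_countable (f n)).comp_aemeasurable (hX n)) fun j => ?_
  have hreal : ∀ n, (P n).real {ω | f n (fun k => X n k ω) = j} =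
      (Measure.pi fun _ : Fin n => ν n).real {x | f n x = j} := by
    intro n
    rw [← hmap n, map_measureReal_apply_of_aemeasurable (hX n) (Set.to_countable _).measurableSet]
    rfl
  simp_rw [hreal]
  have hdiff : Tendsto (fun n => (Measure.pi fun _ : Fin n => ν n).real {x | f n x = j} -
      (Measure.pi fun _ : Fin n => ν n).real {x | numSameUrn (s + 1) Finset.univ x = j})
      atTop (𝓝 0) := by
    refine squeeze_zero_norm' ((eventually_gt_atTop 0).mono fun n hn => ?_)
      (tendsto_pow_mul_meanPowBoxProb_succ hν hmax hmean)
    have := hν n hn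
    refine (abs_measureReal_sub_le fun x hx => ?_).trans (pi_real_exists_sameUrn_le n (s + 1))
    simp only [Set.mem_ofPred_eq, not_exists, not_and, Finset.mem_powersetCard,
      Finset.subset_univ, true_and] at hx
    simp only [Set.mem_ofPred_eq, hf n x hx, Nat.cast_inj]
  have h := hdiff.add (tendsto_pi_real_numSameUrn hν hmax hmean j)
  rw [zero_add] at h
  exact h.congr fun n => by ring

end Limits

theorem mainTheorem3
    {Ω : ℕ → Type*} [∀ n, MeasurableSpace (Ω n)]
    (P : (n : ℕ) → Measure (Ω n)) [∀ n, IsProbabilityMeasure (P n)]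
    (M : ℕ → Set ℕ) (ν : (n : ℕ) → Measure (M n))
    (X : (n : ℕ) → Fin n → Ω n → M n)
    (hlaw : ∀ n k, HasLaw (X n k) (ν n) (P n))
    (hindep : ∀ n, iIndepFun (X n) (P n))
    (hmax : Tendsto (fun n : ℕ => (n : ℝ) * maxBoxProb (ν n)) atTop (𝓝 0)) :
    (∀ (r : ℕ) (μ : ℝ≥0), 1 < r →
      Tendsto (fun n : ℕ => (n : ℝ) ^ r * meanPowBoxProb (ν n) (r - 1)) atTop
        (𝓝 ((r ! : ℝ) * (μ : ℝ))) →
      TendstoInDistribution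
          (fun n (ω : Ω n) => (numFull r (fun k => X n k ω) : ℝ)) atTop
          (fun j : ℕ => (j : ℝ)) P (poissonMeasure μ) ∧
        TendstoInDistribution
          (fun n (ω : Ω n) => (numExact r (fun k => X n k ω) : ℝ)) atTop
          (fun j : ℕ => (j : ℝ)) P (poissonMeasure μ)) ∧
    (∀ μ : ℝ≥0,
      Tendsto (fun n : ℕ => (n : ℝ) ^ 2 * meanPowBoxProb (ν n) 1) atTop
        (𝓝 (2 * (μ : ℝ))) →
      TendstoInDistribution
          (fun n (ω : Ω n) => (n : ℝ) - (numFull 1 (fun k => X n k ω) : ℝ)) atTop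
          (fun j : ℕ => (j : ℝ)) P (poissonMeasure μ) ∧
        TendstoInDistribution
          (fun n (ω : Ω n) => ((n : ℝ) - (numExact 1 (fun k => X n k ω) : ℝ)) / 2) atTop
          (fun j : ℕ => (j : ℝ)) P (poissonMeasure μ)) := by
  refine ⟨fun r μ hr hmean => ?_, fun μ hmean => ?_⟩
  · obtain ⟨s, rfl⟩ : ∃ s, r = s + 1 := ⟨r - 1, by omega⟩
    rw [Nat.add_sub_cancel] at hmean
    refine ⟨tendstoInDistribution_poisson_of_eq_numSameUrn hlaw hindep hmax hmean
      (fun n x => (numFull (s + 1) x : ℝ)) fun n x hx => ?_,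
      tendstoInDistribution_poisson_of_eq_numSameUrn hlaw hindep hmax hmean
      (fun n x => (numExact (s + 1) x : ℝ)) fun n x hx => ?_⟩
    · have hx' := ballCount_le_of_forall_not_sameUrn hx
      rw [numFull_eq_numExact hx', numExact_eq_numSameUrn (Nat.succ_pos s) hx']
    · rw [numExact_eq_numSameUrn (Nat.succ_pos s) (ballCount_le_of_forall_not_sameUrn hx)]
  · have hmean' : Tendsto (fun n : ℕ => (n : ℝ) ^ (1 + 1) * meanPowBoxProb (ν n) 1) atTop
        (𝓝 (((1 + 1)! : ℝ) * (μ : ℝ))) := by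
      simpa [Nat.factorial] using hmean
    refine ⟨tendstoInDistribution_poisson_of_eq_numSameUrn hlaw hindep hmax hmean'
      (fun n x => (n : ℝ) - (numFull 1 x : ℝ)) fun n x hx => ?_,
      tendstoInDistribution_poisson_of_eq_numSameUrn hlaw hindep hmax hmean'
      (fun n x => ((n : ℝ) - (numExact 1 x : ℝ)) / 2) fun n x hx => ?_⟩
    · have hx' := ballCount_le_of_forall_not_sameUrn hx
      have h : (numFull 1 x : ℝ) + numExact 2 x = n := by
        exact_mod_cast numFull_one_add_numExact_two hx'
      rw [← numExact_eq_numSameUrn (Nat.succ_pos 1) hx']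
      linarith
    · have hx' := ballCount_le_of_forall_not_sameUrn hx
      have h : (numExact 1 x : ℝ) + 2 * numExact 2 x = n := by
        exact_mod_cast numExact_one_add_two_mul_numExact_two hx'
      rw [← numExact_eq_numSameUrn (Nat.succ_pos 1) hx']
      linarith
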